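/- Consider a two-bus AC power system. Bus 1 is a load (PQ) bus with given injections $\bar P_1, Q_1$; bus 2 is the only generator and slack bus, with given voltage magnitude $V_2>0$ and scheduled injection $\bar P_2$. They are joined by a branch with series admittance $g-\mathrm{i}b$, $b>0$, shunt susceptance $b_c$ (half at each end) and, at the side of bus 2, a transformer with complex turns ratio $\tau = t e^{\mathrm{i}\theta_s}$, $t>0$. With $y=g-\mathrm{i}b$, the admittance matrix $Y=G+\mathrm{i}B$ has entries $Y_{11}=y+\mathrm{i}b_c/2$, $Y_{12}=-y/\tau$, $Y_{21}=-y/\bar\tau$, $Y_{22}=(y+\mathrm{i}b_c/2)/|\tau|^2$. Put $$\tilde g=\frac{g\cos\theta_s-b\sin\theta_s}{t},\quad \tilde b=\frac{b\cos\theta_s+g\sin\theta_s}{t},\quad \hat b=b-\frac{b_c}{2},\quad \rho=\frac{g}{\hat b},\quad \tilde\rho=\frac{\tilde g}{\tilde b},\quad k_\mu=\frac{b\hat b}{\tilde b^2},$$ let $V_1^\circ=-B_{11}^{-1}B_{12}V_2=(\tilde b/\hat b)V_2$ be the open-circuit load voltage, and let $$\tilde\gamma_P=\frac{\bar P_1}{\tilde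 b V_1^\circ V_2},\qquad \tilde\gamma_Q=\frac{Q_1}{\tilde b V_1^\circ V_2},\qquad \gamma_P=\frac{\bar P_1}{bV_2^2},\qquad \gamma_Q=\frac{Q_1}{bV_2^2},$$ where $\gamma_P,\gamma_Q$ are the values of $\tilde\gamma_P,\tilde\gamma_Q$ in the nominal case $\mu:=(g,b_c,t-1,\theta_s)=0$; thus $\tilde\gamma_P=k_\mu\gamma_P$ and $\tilde\gamma_Q=k_\mu\gamma_Q$. Assume $\hat b>0$, $\tilde b>0$, $\rho\ge 0$, $\tilde\rho\ge 0$, $\gamma_P\le 0$, $\gamma_Q\le 0$ and $0<4\gamma_P^2-4\gamma_Q<1$. Let $$k_2^-=1-\sqrt{\tfrac12+\gamma_Q+\sqrt{\tfrac14+\gamma_Q-\gamma_P^2}},\qquad k_1^-=\frac{-\gamma_P}{1-k_2^-}.$$ For $\xi=(\psi,x)$ define $F_\mu(\xi)=(\psi^+,x^+)$ by $$\psi^+=\frac{-\tilde\gamma_P}{x+1}+\rho(x+1)-\tilde\rho\sqrt{1-\psi^2},\qquad x^+=\frac{\tilde\gamma_Q}{x+1}-\tilde\rho\,\psi^++\sqrt{1-(\psi^+)^2}-1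 .$$ Let $\epsilon=(\epsilon_1,\epsilon_2)$ satisfy $0\le\epsilon_1\le 1-k_1^-$, $0\le\epsilon_2<1-k_2^-$ and the two inequalities $$\frac{-k_\mu\gamma_P}{1-k_2^--\epsilon_2}+\frac{\gamma_P}{1-k_2^-}+\rho(1+k_2^-+\epsilon_2)+\tilde\rho\le\epsilon_1,$$ $$\frac{-k_\mu\gamma_Q}{1-k_2^--\epsilon_2}+(1-k_2^-)+\tilde\rho(k_1^-+\epsilon_1)-\sqrt{1-(k_1^-+\epsilon_1)^2}\le\epsilon_2 .$$ Then the box $\mathcal A_\epsilon^-=\{(\psi,x):|\psi|\le k_1^-+\epsilon_1,\ |x|\le k_2^-+\epsilon_2\}$ is $F_\mu$-invariant, i.e. $F_\mu(\mathcal A_\epsilon^-)\subseteq\mathcal A_\epsilon^-$, and the two-bus system has a power flow solution in $\mathcal A_\epsilon^-$: there are voltage magnitudes $V_1>0$ and $V_2$ (the given one) and phases $\theta_1,\theta_2$ with $\cos(\theta_2-\theta_1)\ge 0$ such that, for some slack power $P_{\mathrm s}$ and with $\varphi_{ij}=\theta_i-\theta_j$, $$V_i\sum_{j=1}^2V_j(G_{ij}\cos\varphi_{ij}+B_{ij}\sin\varphi_{ij})=\begin{cases}\bar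 P_1,&i=1\\ \bar P_2+P_{\mathrm s},&i=2,\end{cases}\qquad V_1\sum_{j=1}^2V_j(G_{1j}\sin\varphi_{1j}-B_{1j}\cos\varphi_{1j})=Q_1,$$ and the point $\xi=(\sin(\theta_2-\theta_1),\,V_1/V_1^\circ-1)$ lies in $\mathcal A_\epsilon^-$ and satisfies $F_\mu(\xi)=\xi$. -/

import Mathlib

/-- Data of a two-bus power system. Bus 1 is a load (PQ) bus, bus 2 is the only generator and slack
bus. The branch is a `Π`-model line with series admittance `g - i b` and shunt susceptance `bc`,
behind a transformer with tap ratio `t` and phase shift `thetaS`, located at the side of bus 2. -/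
structure TwoBusSystem where
  /-- series conductance -/
  g : ℝ
  /-- series susceptance -/
  b : ℝ
  /-- shunt susceptance of the line -/
  bc : ℝ
  /-- transformer tap ratio -/
  t : ℝ
  /-- transformer phase shift -/
  thetaS : ℝ
  /-- voltage magnitude set point at bus 2 -/
  V2 : ℝ
  /-- scheduled real power injection at bus 1 -/
  P1 : ℝ
  /-- scheduled real power injection at bus 2 (not including the slack power) -/
  P2 : ℝ
  /-- reactive power injection at bus 1 -/
  Q1 : ℝ

namespace TwoBusSystem

/-- Complex turns ratio `τ = t exp(i θ_s)`. -/
noncomputable def tau (S : TwoBusSystem) : ℂ :=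
  (S.t : ℂ) * Complex.exp (Complex.I * (S.thetaS : ℂ))

/-- Series admittance `y = g - i b`. -/
noncomputable def ySeries (S : TwoBusSystem) : ℂ := (S.g : ℂ) - Complex.I * (S.b : ℂ)

/-- Bus admittance matrix of the system; index `0` is bus 1 and index `1` is bus 2.
The transformer is at the side of bus 2. -/
noncomputable def Y (S : TwoBusSystem) : Matrix (Fin 2) (Fin 2) ℂ :=
  !![S.ySeries + Complex.I * ((S.bc : ℂ) / 2), -(S.ySeries / S.tau);
     -(S.ySeries / (starRingEnd ℂ) S.tau),
       (S.ySeries + Complex.I * ((S.bc : ℂ) / 2)) / (S.tau * (starRingEnd ℂ) S.tau)]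

/-- Conductance matrix. -/
noncomputable def G (S : TwoBusSystem) (i j : Fin 2) : ℝ := (S.Y i j).re

/-- Susceptance matrix. -/
noncomputable def B (S : TwoBusSystem) (i j : Fin 2) : ℝ := (S.Y i j).im

/-- Right-hand side of the real power flow equation at bus `i`. -/
noncomputable def realPower (S : TwoBusSystem) (V θ : Fin 2 → ℝ) (i : Fin 2) : ℝ :=
  V i * ∑ j, V j * (S.G i j * Real.cos (θ i - θ j) + S.B i j * Real.sin (θ i - θ j))

/-- Right-hand side of the reactive power flow equation at bus `i`. -/
noncomputable def reactivePower (S : TwoBusSystem) (V θ : Fin 2 → ℝ) (i : Fin 2) : ℝ :=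
  V i * ∑ j, V j * (S.G i j * Real.sin (θ i - θ j) - S.B i j * Real.cos (θ i - θ j))

/-- `(V, θ)` is a power flow solution: positive voltage magnitudes, the prescribed magnitude at
bus 2, the real power equations at both buses (bus 2 supplies the unknown slack power `Ps`), and
the reactive power equation at the load bus. -/
def IsPowerFlowSolution (S : TwoBusSystem) (V θ : Fin 2 → ℝ) : Prop :=
  (∀ i, 0 < V i) ∧ V 1 = S.V2 ∧
    (∃ Ps : ℝ, S.realPower V θ 0 = S.P1 ∧ S.realPower V θ 1 = S.P2 + Ps) ∧
    S.reactivePower V θ 0 = S.Q1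

/-- Open-circuit load voltage `V_L° = -B_LL⁻¹ B_LG V_G`. -/
noncomputable def V1open (S : TwoBusSystem) : ℝ := -(S.B 0 0)⁻¹ * S.B 0 1 * S.V2

/-- The constant `g̃`. -/
noncomputable def gTilde (S : TwoBusSystem) : ℝ :=
  (S.g * Real.cos S.thetaS - S.b * Real.sin S.thetaS) / S.t

/-- The constant `b̃`. -/
noncomputable def bTilde (S : TwoBusSystem) : ℝ :=
  (S.b * Real.cos S.thetaS + S.g * Real.sin S.thetaS) / S.t

/-- The constant `b̂`. -/
noncomputable def bHat (S : TwoBusSystem) : ℝ := S.b - S.bc / 2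

/-- The ratio `ρ = g / b̂`. -/
noncomputable def rho (S : TwoBusSystem) : ℝ := S.g / S.bHat

/-- The ratio `ρ̃ = g̃ / b̃`. -/
noncomputable def rhoTilde (S : TwoBusSystem) : ℝ := S.gTilde / S.bTilde

/-- Real power loading margin `γ̃_P`. -/
noncomputable def gammaTildeP (S : TwoBusSystem) : ℝ := S.P1 / (S.bTilde * S.V1open * S.V2)

/-- Reactive power loading margin `γ̃_Q`. -/
noncomputable def gammaTildeQ (S : TwoBusSystem) : ℝ := S.Q1 / (S.bTilde * S.V1open * S.V2)

/-- The nominal system: lossless line, no line shunt, no transformer (`μ = 0`). -/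
def nominal (S : TwoBusSystem) : TwoBusSystem :=
  { S with g := 0, bc := 0, t := 1, thetaS := 0 }

/-- Nominal real power loading margin `γ_P`. -/
noncomputable def gammaP (S : TwoBusSystem) : ℝ := S.nominal.gammaTildeP

/-- Nominal reactive power loading margin `γ_Q`. -/
noncomputable def gammaQ (S : TwoBusSystem) : ℝ := S.nominal.gammaTildeQ

/-- The constant `k_μ = b b̂ / b̃²`. -/
noncomputable def kMu (S : TwoBusSystem) : ℝ := S.b * S.bHat / S.bTilde ^ 2

/-- The constant `k₂⁻`. -/
noncomputable def k2minus (S : TwoBusSystem) : ℝ :=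
  1 - √(1 / 2 + S.gammaQ + √(1 / 4 + S.gammaQ - S.gammaP ^ 2))

/-- The constant `k₁⁻`. -/
noncomputable def k1minus (S : TwoBusSystem) : ℝ := -S.gammaP / (1 - S.k2minus)

/-- First component `ψ_{k+1}` of the update rule, at `ξ = (ψ, x)`. -/
noncomputable def psiNext (S : TwoBusSystem) (ξ : ℝ × ℝ) : ℝ :=
  -S.gammaTildeP / (ξ.2 + 1) + S.rho * (ξ.2 + 1) - S.rhoTilde * √(1 - ξ.1 ^ 2)

/-- The update rule `F_μ`; its second component uses the already updated `ψ_{k+1}`. -/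
noncomputable def F (S : TwoBusSystem) (ξ : ℝ × ℝ) : ℝ × ℝ :=
  (S.psiNext ξ,
    S.gammaTildeQ / (ξ.2 + 1) - S.rhoTilde * S.psiNext ξ + √(1 - S.psiNext ξ ^ 2) - 1)

/-- The box `𝒜(k₁, k₂) = {(ψ, x) : |ψ| ≤ k₁, |x| ≤ k₂}`. -/
def box (k₁ k₂ : ℝ) : Set (ℝ × ℝ) := {ξ | |ξ.1| ≤ k₁ ∧ |ξ.2| ≤ k₂}

/-- The box `𝒜_ε⁻`. -/
noncomputable def boxEps (S : TwoBusSystem) (ε₁ ε₂ : ℝ) : Set (ℝ × ℝ) :=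
  box (S.k1minus + ε₁) (S.k2minus + ε₂)

/-- Coordinates `ξ = (ψ, x)` of `(V, θ)`: `ψ` is the sine of the phase difference along the
forward edge, which runs from bus 2 to bus 1, and `x = V₁ / V₁° - 1`. -/
noncomputable def coords (S : TwoBusSystem) (V θ : Fin 2 → ℝ) : ℝ × ℝ :=
  (Real.sin (θ 1 - θ 0), V 0 / S.V1open - 1)

/-- Standing assumptions: signs of the parameters and the loading restriction. -/
structure Standing (S : TwoBusSystem) : Prop where
  b_pos : 0 < S.b
  t_pos : 0 < S.t
  V2_pos : 0 < S.V2
  bHat_pos : 0 < S.bHat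
  bTilde_pos : 0 < S.bTilde
  rho_nonneg : 0 ≤ S.rho
  rhoTilde_nonneg : 0 ≤ S.rhoTilde
  gammaP_nonpos : S.gammaP ≤ 0
  gammaQ_nonpos : S.gammaQ ≤ 0
  loading_pos : 0 < 4 * S.gammaP ^ 2 - 4 * S.gammaQ
  loading_lt : 4 * S.gammaP ^ 2 - 4 * S.gammaQ < 1

/-- `ε = (ε₁, ε₂)` is nonnegative, lies in the range where the two inequalities make sense, and
satisfies both of them. -/
structure Feasible (S : TwoBusSystem) (ε₁ ε₂ : ℝ) : Prop where
  nonneg₁ : 0 ≤ ε₁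
  nonneg₂ : 0 ≤ ε₂
  range₁ : ε₁ ≤ 1 - S.k1minus
  range₂ : ε₂ < 1 - S.k2minus
  ineq₁ : -S.kMu * S.gammaP / (1 - S.k2minus - ε₂) + S.gammaP / (1 - S.k2minus)
      + S.rho * (1 + S.k2minus + ε₂) + S.rhoTilde ≤ ε₁
  ineq₂ : -S.kMu * S.gammaQ / (1 - S.k2minus - ε₂) + (1 - S.k2minus)
      + S.rhoTilde * (S.k1minus + ε₁) - √(1 - (S.k1minus + ε₁) ^ 2) ≤ ε₂

end TwoBusSystem

/-! Invariance is monotonicity: since `-γ̃_P`, `-γ̃_Q`, `ρ` and `ρ̃` are nonnegative, each term of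
`F` has its extreme value at an edge of the box, and the two inequalities on `ε` are exactly the
resulting worst-case bounds (`abs_psiNext_le`, `voltage_bounds`). No planar fixed point theorem is
needed for existence. For fixed `ψ` the second equation is a quadratic in `v = x + 1`, whose larger
root stays in the box and depends continuously on `ψ` (`larger_root_mem`). Substituting it leaves a
continuous self-map of an interval, to which the intermediate value theorem applies. Clearing
denominators in the fixed point equations then gives the power flow equations at bus 1, while the
slack power absorbs the one at bus 2. -/

namespace TwoBusSystem

variable (S : TwoBusSystem)

/-! ### Entries of the admittance matrix -/

lemma G_zero_zero : S.G 0 0 = S.g := by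
  simp [G, Y, ySeries]

lemma B_zero_zero : S.B 0 0 = -S.bHat := by
  have h : ((S.bc : ℂ) / 2).re = S.bc / 2 := by
    rw [show ((S.bc : ℂ) / 2) = ((S.bc / 2 : ℝ) : ℂ) by push_cast; rfl, Complex.ofReal_re]
  simp [B, Y, ySeries, bHat, h]
  ring

/-- Dividing by `τ` rotates `g - i b` by `-θ_s` and scales it by `1 / t`; `g̃` and `-b̃` are the
real and imaginary parts of the result. -/
lemma ySeries_div_tau (ht : S.t ≠ 0) :
    S.ySeries / S.tau = ((S.gTilde : ℝ) : ℂ) - Complex.I * ((S.bTilde : ℝ) : ℂ) := by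
  have h1 : (S.t : ℂ) ≠ 0 := by exact_mod_cast ht
  have h2 : S.tau ≠ 0 := mul_ne_zero h1 (Complex.exp_ne_zero _)
  rw [div_eq_iff h2]
  have h3 : Complex.exp (Complex.I * (S.thetaS : ℂ))
      = Complex.cos S.thetaS + Complex.sin S.thetaS * Complex.I := by
    rw [mul_comm, Complex.exp_mul_I]
  have h4 := Complex.cos_sq_add_sin_sq (S.thetaS : ℂ)
  simp only [tau, ySeries, gTilde, bTilde, h3]
  push_cast
  field_simp
  linear_combination
    (-(S.g : ℂ) + Complex.I * S.b) * h4 +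
      Complex.sin S.thetaS *
        (S.g * Complex.sin S.thetaS + S.b * Complex.cos S.thetaS) * Complex.I_sq

lemma G_zero_one (ht : S.t ≠ 0) : S.G 0 1 = -S.gTilde := by
  simp [G, Y, S.ySeries_div_tau ht]

lemma B_zero_one (ht : S.t ≠ 0) : S.B 0 1 = S.bTilde := by
  simp [B, Y, S.ySeries_div_tau ht]

lemma V1open_eq (ht : S.t ≠ 0) : S.V1open = S.bTilde / S.bHat * S.V2 := by
  rw [V1open, B_zero_zero, S.B_zero_one ht, inv_neg, neg_neg]
  ring

lemma nominal_V1open (hb : S.b ≠ 0) : S.nominal.V1open = S.V2 := by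
  rw [S.nominal.V1open_eq (by simp [nominal])]
  simp [nominal, bTilde, bHat, hb]

lemma gammaP_eq (hb : S.b ≠ 0) : S.gammaP = S.P1 / (S.b * S.V2 ^ 2) := by
  rw [gammaP, gammaTildeP, S.nominal_V1open hb]
  simp [nominal, bTilde]
  ring

lemma gammaQ_eq (hb : S.b ≠ 0) : S.gammaQ = S.Q1 / (S.b * S.V2 ^ 2) := by
  rw [gammaQ, gammaTildeQ, S.nominal_V1open hb]
  simp [nominal, bTilde]
  ring

variable {S}

lemma Standing.gammaTildeP_eq (hS : S.Standing) : S.gammaTildeP = S.kMu * S.gammaP := by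
  have := hS.b_pos.ne'
  have := hS.V2_pos.ne'
  have := hS.bHat_pos.ne'
  have := hS.bTilde_pos.ne'
  rw [S.gammaP_eq hS.b_pos.ne', gammaTildeP, S.V1open_eq hS.t_pos.ne', kMu]
  field_simp

lemma Standing.gammaTildeQ_eq (hS : S.Standing) : S.gammaTildeQ = S.kMu * S.gammaQ := by
  have := hS.b_pos.ne'
  have := hS.V2_pos.ne'
  have := hS.bHat_pos.ne'
  have := hS.bTilde_pos.ne'
  rw [S.gammaQ_eq hS.b_pos.ne', gammaTildeQ, S.V1open_eq hS.t_pos.ne', kMu]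
  field_simp

lemma Standing.kMu_pos (hS : S.Standing) : 0 < S.kMu :=
  div_pos (mul_pos hS.b_pos hS.bHat_pos) (pow_pos hS.bTilde_pos 2)

lemma Standing.V1open_pos (hS : S.Standing) : 0 < S.V1open := by
  rw [S.V1open_eq hS.t_pos.ne']
  exact mul_pos (div_pos hS.bTilde_pos hS.bHat_pos) hS.V2_pos

lemma Standing.gammaTildeP_nonpos (hS : S.Standing) : S.gammaTildeP ≤ 0 := by
  rw [hS.gammaTildeP_eq]
  exact mul_nonpos_of_nonneg_of_nonpos hS.kMu_pos.le hS.gammaP_nonpos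

lemma Standing.gammaTildeQ_nonpos (hS : S.Standing) : S.gammaTildeQ ≤ 0 := by
  rw [hS.gammaTildeQ_eq]
  exact mul_nonpos_of_nonneg_of_nonpos hS.kMu_pos.le hS.gammaQ_nonpos

/-- The loading bound forces `γ_Q > -1/4`, so the outer radicand is positive even without the inner
root. -/
lemma Standing.one_sub_k2minus_pos (hS : S.Standing) : 0 < 1 - S.k2minus := by
  have h := hS.loading_lt
  rw [k2minus, sub_sub_cancel, Real.sqrt_pos]
  have := Real.sqrt_nonneg (1 / 4 + S.gammaQ - S.gammaP ^ 2)
  nlinarith [sq_nonneg S.gammaP]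

lemma Standing.k1minus_nonneg (hS : S.Standing) : 0 ≤ S.k1minus :=
  div_nonneg (neg_nonneg.2 hS.gammaP_nonpos) hS.one_sub_k2minus_pos.le

/-! ### Invariance of the box -/

variable {ε₁ ε₂ : ℝ}

lemma one_sub_le_of_abs_le {x : ℝ} (hx : |x| ≤ S.k2minus + ε₂) :
    1 - S.k2minus - ε₂ ≤ x + 1 := by
  linarith [(abs_le.1 hx).1]

/-- No bound on `ξ.1` is needed: `√(1 - ξ.1 ^ 2)` always lies in `[0, 1]`, a negative radicand
giving `0`. The lower bound holds because the first inequality also yields `ρ̃ ≤ k₁⁻ + ε₁`. -/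
lemma Feasible.abs_psiNext_le (hS : S.Standing) (hε : S.Feasible ε₁ ε₂) {ξ : ℝ × ℝ}
    (hx : |ξ.2| ≤ S.k2minus + ε₂) : |S.psiNext ξ| ≤ S.k1minus + ε₁ := by
  have hd : 0 < 1 - S.k2minus - ε₂ := by linarith [hε.range₂]
  have hv := one_sub_le_of_abs_le hx
  have hv0 : 0 < ξ.2 + 1 := hd.trans_le hv
  have hP : 0 ≤ -S.gammaTildeP := neg_nonneg.2 hS.gammaTildeP_nonpos
  have h1 : -S.gammaTildeP / (ξ.2 + 1) ≤ -S.gammaTildeP / (1 - S.k2minus - ε₂) :=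
    div_le_div_of_nonneg_left hP hd hv
  have h2 : 0 ≤ -S.gammaTildeP / (ξ.2 + 1) := div_nonneg hP hv0.le
  have h3 : S.rho * (ξ.2 + 1) ≤ S.rho * (1 + S.k2minus + ε₂) :=
    mul_le_mul_of_nonneg_left (by linarith [(abs_le.1 hx).2]) hS.rho_nonneg
  have h4 : 0 ≤ S.rho * (ξ.2 + 1) := mul_nonneg hS.rho_nonneg hv0.le
  have h5 : S.rhoTilde * √(1 - ξ.1 ^ 2) ≤ S.rhoTilde :=
    mul_le_of_le_one_right hS.rhoTilde_nonneg
      (Real.sqrt_le_one.2 (by linarith [sq_nonneg ξ.1]))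
  have h6 : 0 ≤ S.rhoTilde * √(1 - ξ.1 ^ 2) :=
    mul_nonneg hS.rhoTilde_nonneg (Real.sqrt_nonneg _)
  have h7 := hε.ineq₁
  rw [neg_mul, ← hS.gammaTildeP_eq] at h7
  have h8 : S.gammaP / (1 - S.k2minus) = -S.k1minus := by rw [k1minus, neg_div, neg_neg]
  have h9 := hS.rhoTilde_nonneg
  rw [abs_le, psiNext]
  constructor <;> linarith

/-- The terms of the second component of the update rule that depend on `ψ` only are bounded
above by the largest, and below by a perturbation of the smallest, voltage in the box. -/
lemma Feasible.voltage_bounds (hS : S.Standing) (hε : S.Feasible ε₁ ε₂) {ψ : ℝ}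
    (hψ : |ψ| ≤ S.k1minus + ε₁) :
    1 - S.k2minus - ε₂ ≤ S.gammaTildeQ / (1 - S.k2minus - ε₂)
        + (-S.rhoTilde * ψ + √(1 - ψ ^ 2)) ∧
      -S.rhoTilde * ψ + √(1 - ψ ^ 2) ≤ 1 + S.k2minus + ε₂ := by
  have hd : 0 < 1 - S.k2minus - ε₂ := by linarith [hε.range₂]
  have h1 := hε.ineq₂
  rw [neg_mul, ← hS.gammaTildeQ_eq, neg_div] at h1
  have h2 : S.gammaTildeQ / (1 - S.k2minus - ε₂) ≤ 0 :=
    div_nonpos_of_nonpos_of_nonneg hS.gammaTildeQ_nonpos hd.le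
  have h3 : √(1 - (S.k1minus + ε₁) ^ 2) ≤ √(1 - ψ ^ 2) :=
    Real.sqrt_le_sqrt (by linarith [sq_le_sq' (abs_le.1 hψ).1 (abs_le.1 hψ).2])
  have h4 : |S.rhoTilde * ψ| ≤ S.rhoTilde * (S.k1minus + ε₁) := by
    rw [abs_mul, abs_of_nonneg hS.rhoTilde_nonneg]
    exact mul_le_mul_of_nonneg_left hψ hS.rhoTilde_nonneg
  obtain ⟨h5, h6⟩ := abs_le.1 h4
  have h7 : √(1 - ψ ^ 2) ≤ 1 := Real.sqrt_le_one.2 (by linarith [sq_nonneg ψ])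
  -- With this, the second inequality also gives `ρ̃ (k₁⁻ + ε₁) ≤ k₂⁻ + ε₂`, hence the upper bound.
  have h8 : √(1 - (S.k1minus + ε₁) ^ 2) ≤ 1 := h3.trans h7
  constructor <;> linarith

theorem Feasible.mapsTo_boxEps (hS : S.Standing) (hε : S.Feasible ε₁ ε₂) :
    Set.MapsTo S.F (S.boxEps ε₁ ε₂) (S.boxEps ε₁ ε₂) := by
  rintro ξ ⟨-, hx⟩
  have hψ := hε.abs_psiNext_le hS hx
  refine ⟨hψ, ?_⟩
  have hd : 0 < 1 - S.k2minus - ε₂ := by linarith [hε.range₂]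
  have hv := one_sub_le_of_abs_le hx
  obtain ⟨h1, h2⟩ := hε.voltage_bounds hS hψ
  have h3 : -S.gammaTildeQ / (ξ.2 + 1) ≤ -S.gammaTildeQ / (1 - S.k2minus - ε₂) :=
    div_le_div_of_nonneg_left (neg_nonneg.2 hS.gammaTildeQ_nonpos) hd hv
  have h4 : S.gammaTildeQ / (ξ.2 + 1) ≤ 0 :=
    div_nonpos_of_nonpos_of_nonneg hS.gammaTildeQ_nonpos (hd.trans_le hv).le
  rw [neg_div, neg_div] at h3
  simp only [F]
  rw [abs_le]
  constructor <;> linarith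

/-! ### Existence of a fixed point -/

/-- If `a > 0` satisfies `a ≤ q / a + c` with `q ≤ 0`, then the larger root of `v² = q + c v` lies
in `[a, c]`. -/
lemma larger_root_mem {a c q : ℝ} (ha : 0 < a) (hq : q ≤ 0) (h : a ≤ q / a + c) :
    a ≤ (c + √(c ^ 2 + 4 * q)) / 2 ∧ (c + √(c ^ 2 + 4 * q)) / 2 ≤ c ∧
      (c + √(c ^ 2 + 4 * q)) / 2 = q / ((c + √(c ^ 2 + 4 * q)) / 2) + c := by
  have hc : 0 < c := by linarith [div_nonpos_of_nonpos_of_nonneg hq ha.le]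
  have h1 : a * a ≤ q + c * a := by
    have := mul_le_mul_of_nonneg_right h ha.le
    rwa [add_mul, div_mul_cancel₀ _ ha.ne'] at this
  -- Completing the square: `a` lies between the roots, and the discriminant is nonnegative.
  have h2 : (2 * a - c) ^ 2 ≤ c ^ 2 + 4 * q := by linarith
  have h3 : 2 * a - c ≤ √(c ^ 2 + 4 * q) := Real.le_sqrt_of_sq_le h2
  have h4 : √(c ^ 2 + 4 * q) ≤ c := by
    rw [Real.sqrt_le_left hc.le]
    linarith
  have h5 : √(c ^ 2 + 4 * q) ^ 2 = c ^ 2 + 4 * q := Real.sq_sqrt ((sq_nonneg _).trans h2)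
  have h6 : a ≤ (c + √(c ^ 2 + 4 * q)) / 2 := by linarith
  refine ⟨h6, by linarith, ?_⟩
  have h7 : (c + √(c ^ 2 + 4 * q)) / 2 ≠ 0 := (ha.trans_le h6).ne'
  rw [← sub_eq_iff_eq_add, eq_div_iff h7]
  linear_combination h5 / 4

/-- A continuous self-map of a symmetric interval has a fixed point. -/
lemma exists_fixed_point_of_abs_le {f : ℝ → ℝ} {K : ℝ} (hK : 0 ≤ K)
    (hf : ContinuousOn f (Set.Icc (-K) K)) (h : ∀ x, |x| ≤ K → |f x| ≤ K) :
    ∃ x, |x| ≤ K ∧ f x = x := by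
  have hl : (-K) ≤ f (-K) := (abs_le.1 (h (-K) (by rw [abs_neg, abs_of_nonneg hK]))).1
  have hr : f K ≤ K := (abs_le.1 (h K (abs_of_nonneg hK).le)).2
  obtain ⟨x, hx, hx0⟩ := intermediate_value_Icc' (by linarith : -K ≤ K) (hf.sub continuousOn_id)
    (show (0 : ℝ) ∈ Set.Icc (f K - K) (f (-K) - -K) from ⟨by linarith, by linarith⟩)
  exact ⟨x, abs_le.2 hx, sub_eq_zero.1 hx0⟩

theorem Feasible.exists_fixed_point (hS : S.Standing) (hε : S.Feasible ε₁ ε₂) :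
    ∃ ξ ∈ S.boxEps ε₁ ε₂, S.F ξ = ξ := by
  have hd : 0 < 1 - S.k2minus - ε₂ := by linarith [hε.range₂]
  set c : ℝ → ℝ := fun ψ ↦ -S.rhoTilde * ψ + √(1 - ψ ^ 2) with hc
  -- The high-voltage root of `v² = γ̃_Q + c v`, which eliminates the second equation.
  set v : ℝ → ℝ := fun ψ ↦ (c ψ + √(c ψ ^ 2 + 4 * S.gammaTildeQ)) / 2 with hv
  have hroot : ∀ ψ, |ψ| ≤ S.k1minus + ε₁ →
      1 - S.k2minus - ε₂ ≤ v ψ ∧ v ψ ≤ c ψ ∧ v ψ = S.gammaTildeQ / v ψ + c ψ := fun ψ hψ ↦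
    larger_root_mem hd hS.gammaTildeQ_nonpos (hε.voltage_bounds hS hψ).1
  have hbox : ∀ ψ, |ψ| ≤ S.k1minus + ε₁ → |v ψ - 1| ≤ S.k2minus + ε₂ := fun ψ hψ ↦ by
    obtain ⟨h1, h2, -⟩ := hroot ψ hψ
    have h3 : c ψ ≤ 1 + S.k2minus + ε₂ := (hε.voltage_bounds hS hψ).2
    rw [abs_le]
    constructor <;> linarith
  have hvc : Continuous v := by
    simp only [hv, hc]
    fun_prop
  have hcont : ContinuousOn (fun ψ ↦ S.psiNext (ψ, v ψ - 1))
      (Set.Icc (-(S.k1minus + ε₁)) (S.k1minus + ε₁)) := by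
    simp only [psiNext, sub_add_cancel]
    refine ((continuousOn_const.div hvc.continuousOn fun ψ hψ ↦ ?_).add ?_).sub ?_
    · exact (hd.trans_le (hroot ψ (abs_le.2 hψ)).1).ne'
    · fun_prop
    · fun_prop
  obtain ⟨ψ, hψ, hfix⟩ := exists_fixed_point_of_abs_le
    (add_nonneg hS.k1minus_nonneg hε.nonneg₁) hcont
    fun ψ hψ ↦ hε.abs_psiNext_le hS (hbox ψ hψ)
  refine ⟨(ψ, v ψ - 1), ⟨hψ, hbox ψ hψ⟩, ?_⟩
  have h := (hroot ψ hψ).2.2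
  have hcψ : c ψ = -S.rhoTilde * ψ + √(1 - ψ ^ 2) := rfl
  -- The second component of `F` uses the updated `ψ`, which here equals `ψ`, so it reduces to the
  -- quadratic solved by `v ψ`.
  rw [F, hfix]
  refine Prod.ext rfl ?_
  simp only [sub_add_cancel]
  linarith

/-! ### Fixed points are power flow solutions -/

/-- The phase `arcsin ψ` selects the branch with cosine `+√(1 - ψ ^ 2)`, the one built into `F`. -/
theorem Standing.isPowerFlowSolution_of_fixed_point (hS : S.Standing) {ψ x : ℝ}
    (hψ : |ψ| ≤ 1) (hx : 0 < x + 1) (hF : S.F (ψ, x) = (ψ, x)) :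
    S.IsPowerFlowSolution ![S.V1open * (x + 1), S.V2] ![0, Real.arcsin ψ] := by
  have hV := hS.V1open_pos
  have hV2 := hS.V2_pos
  have hbt := hS.bTilde_pos
  have hbh := hS.bHat_pos
  have ht := hS.t_pos.ne'
  have hsin : Real.sin (Real.arcsin ψ) = ψ := Real.sin_arcsin (abs_le.1 hψ).1 (abs_le.1 hψ).2
  have hcos : Real.cos (Real.arcsin ψ) = √(1 - ψ ^ 2) := Real.cos_arcsin ψ
  have e1 : S.psiNext (ψ, x) = ψ := congrArg Prod.fst hF
  have e2 : (S.F (ψ, x)).2 = x := congrArg Prod.snd hF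
  simp only [F, e1] at e2
  simp only [psiNext] at e1
  -- This relation turns the self-admittance terms, in `g` and `b̂`, into multiples of the common
  -- factor `b̃ V₁° V₂`.
  have hVo : S.V1open * S.bHat = S.bTilde * S.V2 := by
    rw [S.V1open_eq ht]
    field_simp
  have hg : S.rho * S.bHat = S.g := div_mul_cancel₀ _ hbh.ne'
  have hgt : S.rhoTilde * S.bTilde = S.gTilde := div_mul_cancel₀ _ hbt.ne'
  have hD : 0 < S.bTilde * S.V1open * S.V2 := by positivity
  have hP : S.gammaTildeP * (S.bTilde * S.V1open * S.V2) = S.P1 := div_mul_cancel₀ _ hD.ne'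
  have hQ : S.gammaTildeQ * (S.bTilde * S.V1open * S.V2) = S.Q1 := div_mul_cancel₀ _ hD.ne'
  have e1' : S.gammaTildeP
      = (x + 1) * (S.rho * (x + 1) - S.rhoTilde * √(1 - ψ ^ 2) - ψ) := by
    field_simp at e1
    linarith
  have e2' : S.gammaTildeQ = (x + 1) * (x + 1 + S.rhoTilde * ψ - √(1 - ψ ^ 2)) := by
    field_simp at e2
    linarith
  refine ⟨?_, rfl, ⟨S.realPower _ _ 1 - S.P2, ?_, by ring⟩, ?_⟩
  · rw [Fin.forall_fin_two]
    exact ⟨mul_pos hV hx, hV2⟩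
  · simp only [realPower, Fin.sum_univ_two, G_zero_zero, S.G_zero_one ht,
      S.B_zero_one ht, Matrix.cons_val_zero, Matrix.cons_val_one, zero_sub,
      Real.cos_zero, Real.sin_zero, Real.cos_neg, Real.sin_neg, hsin, hcos]
    rw [← hP, e1', ← hgt, ← hg]
    linear_combination S.V1open * (x + 1) ^ 2 * S.rho * hVo
  · simp only [reactivePower, Fin.sum_univ_two, B_zero_zero, S.G_zero_one ht,
      S.B_zero_one ht, Matrix.cons_val_zero, Matrix.cons_val_one, zero_sub,
      Real.cos_zero, Real.sin_zero, Real.cos_neg, Real.sin_neg, hsin, hcos]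
    rw [← hQ, e2', ← hgt]
    linear_combination S.V1open * (x + 1) ^ 2 * hVo

end TwoBusSystem

theorem proposition1 (S : TwoBusSystem) (hS : S.Standing) (ε₁ ε₂ : ℝ)
    (hε : S.Feasible ε₁ ε₂) :
    Set.MapsTo S.F (S.boxEps ε₁ ε₂) (S.boxEps ε₁ ε₂) ∧
      ∃ V θ : Fin 2 → ℝ, S.IsPowerFlowSolution V θ ∧
        0 ≤ Real.cos (θ 1 - θ 0) ∧
        S.coords V θ ∈ S.boxEps ε₁ ε₂ ∧
        S.F (S.coords V θ) = S.coords V θ := by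
  refine ⟨hε.mapsTo_boxEps hS, ?_⟩
  obtain ⟨⟨ψ, x⟩, hmem, hF⟩ := hε.exists_fixed_point hS
  have hψ : |ψ| ≤ 1 := hmem.1.trans (by linarith [hε.range₁])
  have hx : 0 < x + 1 :=
    (by linarith [hε.range₂] : 0 < 1 - S.k2minus - ε₂).trans_le
      (TwoBusSystem.one_sub_le_of_abs_le hmem.2)
  have hcoords : S.coords ![S.V1open * (x + 1), S.V2] ![0, Real.arcsin ψ] = (ψ, x) := by
    simp only [TwoBusSystem.coords, Matrix.cons_val_zero, Matrix.cons_val_one, sub_zero,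
      Real.sin_arcsin (abs_le.1 hψ).1 (abs_le.1 hψ).2,
      mul_div_cancel_left₀ _ hS.V1open_pos.ne', add_sub_cancel_right]
  refine ⟨_, _, hS.isPowerFlowSolution_of_fixed_point hψ hx hF, ?_, ?_, ?_⟩
  · simpa using Real.cos_arcsin_nonneg ψ
  · rwa [hcoords]
  · rwa [hcoords]
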